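/- Let $p$ be a prime, let $G$ be a $p$-adic Lie group of dimension $d$, and let $W$ be a $\mathbb{Q}_p$-Banach space representation of $G$ (a $\mathbb{Q}_p$-Banach space, with non-archimedean norm, with a linear action of $G$ such that $G\times W\to W$ is continuous). Fix a compact open subgroup $G_0$ of $G$ equipped with an integer valued, saturated $p$-valuation $v$ defining its topology, and an ordered basis $g_1,\dots,g_d$ of $(G_0,v)$; that is, $(x_1,\dots,x_d)\mapsto g_1^{x_1}\cdots g_d^{x_d}$ is a homeomorphism $\mathbb{Z}_p^d\to G_0$ and $v(g_1^{x_1}\cdots g_d^{x_d})=\min_i\,(v(g_i)+v_p(x_i))$. For $n\ge 0$ let $G_n=G_0^{p^n}$ be the subgroup of $p^n$-th powers, and let $\mathscr{C}^{\mathrm{an}}(G_n,W)$ be the Banach space of functions $f:G_n\to W$ of the form $$f(g_1^{x_1}\cdots g_d^{x_d})=\sum_{k\in\mathbb{N}^d}x_1^{k_1}\cdots x_d^{k_d}\,c_k,\qquad c_k\in W,\quad p^{n|k|}c_k\to 0,$$ with norm $\sup_k\|p^{n|k|}c_k\|$ and with $G_n$-action $(g\cdot f)(h)=g(f(g^{-1}h))$.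 Restriction of cochains and of analytic functions from $G_n$ to $G_m$ for $m\ge n$ makes the continuous cohomology groups $H^i_{\mathrm{cont}}(G_n,\mathscr{C}^{\mathrm{an}}(G_n,W))$ into a direct system in $n$. For $i\ge 1$ put $$R^i\mathfrak{LA}(W)=\varinjlim_n H^i_{\mathrm{cont}}\left(G_n,\mathscr{C}^{\mathrm{an}}(G_n,W)\right).$$ Call $W$ $\mathfrak{LA}$-acyclic if $R^i\mathfrak{LA}(W)=0$ for all $i\ge 1$, and strongly $\mathfrak{LA}$-acyclic if for all $i\ge 1$ and $n\ge 0$ there is $m\ge n$ such that $$H^i_{\mathrm{cont}}(G_n,\mathscr{C}^{\mathrm{an}}(G_n,W))\to H^i_{\mathrm{cont}}(G_m,\mathscr{C}^{\mathrm{an}}(G_m,W))$$ is the zero map. Then $W$ is $\mathfrak{LA}$-acyclic if and only if it is strongly $\mathfrak{LA}$-acyclic. -/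

import Mathlib

open scoped ZeroAtInfty Manifold ContDiff

noncomputable section

namespace LocAn

/-- `v` is an integer valued, saturated `p`-valuation on the topological group `H`, which defines
the topology of `H`. As usual `v 1 = ∞`. Since `v` is integer valued and `1 / (p - 1) < v`, its
values off `1` are positive integers, so it is written as a function to `ℕ∞`; the inequalities
`1 / (p - 1) < v g` and `p / (p - 1) < v g` are written without denominators. -/
structure IsIntegralSaturatedPValuation (p : ℕ) {H : Type*} [Group H] [TopologicalSpace H]
    (v : H → ℕ∞) : Prop where
  eq_top_iff : ∀ g, v g = ⊤ ↔ g = 1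
  one_lt : ∀ g, 1 < ((p - 1 : ℕ) : ℕ∞) * v g
  min_le_mul_inv : ∀ g h, min (v g) (v h) ≤ v (g * h⁻¹)
  add_le_commutator : ∀ g h, v g + v h ≤ v (g * h * g⁻¹ * h⁻¹)
  map_pow : ∀ g, v (g ^ p) = v g + 1
  saturated : ∀ g, (p : ℕ∞) < ((p - 1 : ℕ) : ℕ∞) * v g → ∃ h, h ^ p = g
  nhds_one : (nhds (1 : H)).HasBasis (fun _ : ℕ => True) (fun n => {g | (n : ℕ∞) ≤ v g})

/-- An ordered basis `g₁, …, g_d` of a group `H` with `p`-valuation `v`: the map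
`(x₁, …, x_d) ↦ g₁ ^ x₁ ⋯ g_d ^ x_d` is a homeomorphism from `ℤ_p ^ d` to `H`, and
`v (g₁ ^ x₁ ⋯ g_d ^ x_d)` is the minimum of the `v (g_i) + v_p(x_i)`.
The product with `p`-adic exponents is the continuous extension of the one with exponents in `ℕ`,
so it is determined by `coord_natCast`. -/
structure OrderedBasis (p : ℕ) [Fact p.Prime] {H : Type*} [Group H] [TopologicalSpace H]
    (v : H → ℕ∞) (d : ℕ) where
  gen : Fin d → H
  coord : (Fin d → ℤ_[p]) ≃ₜ H
  coord_natCast : ∀ k : Fin d → ℕ,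
    coord (fun i => (k i : ℤ_[p])) = (List.ofFn fun i => gen i ^ k i).prod
  val_coord : ∀ x : Fin d → ℤ_[p],
    v (coord x) = ⨅ i, (v (gen i) + emultiplicity (p : ℤ_[p]) (x i))

/-- The subgroup `H_n = H ^ (p ^ n)` generated by the `p ^ n`-th powers of elements of `H`. -/
def powSubgroup (p : ℕ) (H : Type*) [Group H] (n : ℕ) : Subgroup H :=
  Subgroup.closure (Set.range fun g : H => g ^ p ^ n)

theorem powSubgroup_le (p : ℕ) (H : Type*) [Group H] {n m : ℕ} (h : n ≤ m) :
    powSubgroup p H m ≤ powSubgroup p H n := by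
  refine (Subgroup.closure_le _).2 ?_
  rintro _ ⟨g, rfl⟩
  refine Subgroup.subset_closure ⟨g ^ p ^ (m - n), ?_⟩
  simp only
  rw [← pow_mul, ← pow_add, Nat.sub_add_cancel h]

section

variable {p : ℕ} [Fact p.Prime] {H : Type*} [Group H] [TopologicalSpace H]
  {v : H → ℕ∞} {d : ℕ} (b : OrderedBasis p v d)
  {W : Type*} [NormedAddCommGroup W] [NormedSpace ℚ_[p] W]

/-- The monomial `∏ (x_i(h) / p ^ n) ^ k_i`, where `x_i` are the coordinates of `h` with respect
to the ordered basis. On `H_n` the functions `x_i / p ^ n` take all values in `ℤ_p`. -/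
def monomial (n : ℕ) (k : Fin d → ℕ) (h : H) : ℚ_[p] :=
  ∏ i, (((b.coord.symm h i : ℤ_[p]) : ℚ_[p]) / (p : ℚ_[p]) ^ n) ^ k i

/-- `f : H_n → W` is the analytic function with expansion
`f(h) = ∑_k ∏ (x_i(h) / p ^ n) ^ k_i • a_k`, where `a_k → 0`.

The space `𝒞^an(H_n, W)` consists of the `f` that have such an expansion (equivalently
`f(h) = ∑_k x(h) ^ k • c_k` with `p ^ (n |k|) c_k → 0`). Its Banach space structure is given by
the norm `sup_k ‖a_k‖`, that is, by the identification `f ↔ a` with the Banach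
space `C₀(Fin d → ℕ, W)` of null families (with the sup norm). -/
def HasExpansion (n : ℕ) (f : powSubgroup p H n → W) (a : C₀(Fin d → ℕ, W)) : Prop :=
  ∀ h : powSubgroup p H n, HasSum (fun k => monomial b n k (h : H) • a k) (f h)

/-- The action `(g • f)(h) = g (f (g⁻¹ h))` of `H_n` on functions `f : H_n → W`. -/
def funRep (ρ : Representation ℚ_[p] H W) (n : ℕ) :
    Representation ℚ_[p] (powSubgroup p H n) (powSubgroup p H n → W) where
  toFun g :=
    { toFun := fun f h => ρ g (f (g⁻¹ * h))
      map_add' := fun f f' => by ext h; simp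
      map_smul' := fun c f => by ext h; simp }
  map_one' := by ext f h; simp
  map_mul' g g' := by ext f h; simp [mul_assoc]

/-- The differential on inhomogeneous cochains with values in functions on `H_n`,
`(dφ)(g₀,…,g_i) = g₀ • φ(g₁,…,g_i) + ∑_j (-1)^(j+1) φ(…,g_j g_(j+1),…)
  + (-1)^(i+1) φ(g₀,…,g_(i-1))`. -/
def diff (ρ : Representation ℚ_[p] H W) (n i : ℕ) :
    ((Fin i → powSubgroup p H n) → powSubgroup p H n → W) →ₗ[ℚ_[p]]
      ((Fin (i + 1) → powSubgroup p H n) → powSubgroup p H n → W) :=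
  { toFun := fun φ g => funRep ρ n (g 0) (φ fun j => g j.succ) +
      ∑ j : Fin (i + 1), (-1 : ℚ_[p]) ^ ((j : ℕ) + 1) • φ (Fin.contractNth j (· * ·) g)
    map_add' := fun φ ψ => by
      funext g
      simp [Finset.sum_add_distrib, add_add_add_comm]
    map_smul' := fun c φ => by
      funext g
      simp [Finset.smul_sum, smul_comm c] }

/-- In bundled terms this is the differential of group cohomology of the representation on all
functions. -/
theorem diff_eq {H : Type} [Group H] {W : Type*} [NormedAddCommGroup W]
    [NormedSpace ℚ_[p] W] (ρ : Representation ℚ_[p] H W) (n i : ℕ) :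
    diff ρ n i = (inhomogeneousCochains.d (Rep.of (funRep ρ n)) i).hom := rfl

/-- The continuous inhomogeneous `i`-cochains `H_n ^ i → 𝒞^an(H_n, W)`: those maps to functions on
`H_n` whose values are analytic and depend continuously, for the Banach space topology of
`𝒞^an(H_n, W)`, on the argument. -/
def cochains (W : Type*) [NormedAddCommGroup W] [NormedSpace ℚ_[p] W] (n i : ℕ) :
    Submodule ℚ_[p] ((Fin i → powSubgroup p H n) → powSubgroup p H n → W) where
  carrier := {φ | ∃ A : (Fin i → powSubgroup p H n) → C₀(Fin d → ℕ, W),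
    Continuous A ∧ ∀ g, HasExpansion b n (φ g) (A g)}
  add_mem' := by
    rintro φ ψ ⟨A, hA, hφ⟩ ⟨B, hB, hψ⟩
    refine ⟨fun g => A g + B g, hA.add hB, fun g h => ?_⟩
    simpa [smul_add] using (hφ g h).add (hψ g h)
  zero_mem' := ⟨fun _ => 0, continuous_const, fun g h => by simp⟩
  smul_mem' := by
    rintro c φ ⟨A, hA, hφ⟩
    refine ⟨fun g => c • A g, hA.const_smul c, fun g h => ?_⟩
    simpa [smul_comm c] using (hφ g h).const_smul c

/-- Continuous `i`-cocycles of `H_n` with values in `𝒞^an(H_n, W)`. -/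
def cocycles (ρ : Representation ℚ_[p] H W) (n i : ℕ) :
    Submodule ℚ_[p] ((Fin i → powSubgroup p H n) → powSubgroup p H n → W) :=
  cochains b W n i ⊓ LinearMap.ker (diff ρ n i)

/-- Continuous `i`-coboundaries of `H_n` with values in `𝒞^an(H_n, W)`: the differentials of
continuous `(i - 1)`-cochains with values in `𝒞^an(H_n, W)`, and `0` for `i = 0`. -/
def coboundaries (ρ : Representation ℚ_[p] H W) (n : ℕ) : (i : ℕ) →
    Submodule ℚ_[p] ((Fin i → powSubgroup p H n) → powSubgroup p H n → W)
  | 0 => ⊥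
  | i + 1 => (cochains b W n i).map (diff ρ n i)

/-- The continuous cohomology `H^i_cont(H_n, 𝒞^an(H_n, W))`: cocycles modulo coboundaries. -/
abbrev Hcont (ρ : Representation ℚ_[p] H W) (n i : ℕ) : Type _ :=
  cocycles b ρ n i ⧸ (coboundaries b ρ n i).submoduleOf (cocycles b ρ n i)

/-- Restriction of cochains from `H_n` to `H_m` for `n ≤ m`, in the arguments of the cochain as
well as in those of its values. -/
def resFun (p : ℕ) [Fact p.Prime] (H : Type*) [Group H] (W : Type*) [NormedAddCommGroup W]
    [NormedSpace ℚ_[p] W] {n m : ℕ} (hnm : n ≤ m) (i : ℕ) :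
    ((Fin i → powSubgroup p H n) → powSubgroup p H n → W) →ₗ[ℚ_[p]]
      ((Fin i → powSubgroup p H m) → powSubgroup p H m → W) where
  toFun φ g h := φ (fun j => Subgroup.inclusion (powSubgroup_le p H hnm) (g j))
    (Subgroup.inclusion (powSubgroup_le p H hnm) h)
  map_add' _ _ := rfl
  map_smul' _ _ := rfl

theorem monomial_le {n m : ℕ} (hnm : n ≤ m) (k : Fin d → ℕ) (h : H) :
    monomial b n k h = monomial b m k h * ((p : ℚ_[p]) ^ (m - n)) ^ (∑ i, k i) := by
  have hp : (p : ℚ_[p]) ≠ 0 := by exact_mod_cast (Fact.out : p.Prime).ne_zero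
  unfold monomial
  rw [← Finset.prod_pow_eq_pow_sum, ← Finset.prod_mul_distrib]
  refine Finset.prod_congr rfl fun i _ => ?_
  rw [← mul_pow]
  congr 1
  obtain ⟨q, rfl⟩ := Nat.exists_eq_add_of_le hnm
  rw [Nat.add_sub_cancel_left, pow_add]
  field_simp

/-- Multiplication of the `k`-th coefficient by `p ^ (q |k|)`. -/
def rescale (p : ℕ) [Fact p.Prime] {d : ℕ} {W : Type*} [NormedAddCommGroup W] [NormedSpace ℚ_[p] W]
    (q : ℕ) (a : C₀(Fin d → ℕ, W)) : C₀(Fin d → ℕ, W) where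
  toFun k := ((p : ℚ_[p]) ^ q) ^ (∑ i, k i) • a k
  continuous_toFun := continuous_of_discreteTopology
  zero_at_infty' := by
    refine squeeze_zero_norm (fun k => ?_) (tendsto_zero_iff_norm_tendsto_zero.1 a.zero_at_infty')
    rw [norm_smul]
    refine mul_le_of_le_one_left (norm_nonneg _) ?_
    rw [norm_pow, norm_pow]
    exact pow_le_one₀ (by positivity) (pow_le_one₀ (norm_nonneg _) (Padic.norm_p_lt_one).le)

theorem continuous_rescale (q : ℕ) :
    Continuous (rescale p q : C₀(Fin d → ℕ, W) → C₀(Fin d → ℕ, W)) := by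
  refine LipschitzWith.continuous (K := 1) (LipschitzWith.of_dist_le_mul fun a a' => ?_)
  rw [NNReal.coe_one, one_mul, ← ZeroAtInftyContinuousMap.dist_toBCF_eq_dist,
    BoundedContinuousFunction.dist_le dist_nonneg]
  intro k
  refine le_trans ?_ (BoundedContinuousFunction.dist_coe_le_dist k)
  change dist (((p : ℚ_[p]) ^ q) ^ (∑ i, k i) • a k) (((p : ℚ_[p]) ^ q) ^ (∑ i, k i) • a' k) ≤
    dist (a k) (a' k)
  rw [dist_eq_norm, dist_eq_norm, ← smul_sub, norm_smul]
  refine mul_le_of_le_one_left (norm_nonneg _) ?_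
  rw [norm_pow, norm_pow]
  exact pow_le_one₀ (by positivity) (pow_le_one₀ (norm_nonneg _) (Padic.norm_p_lt_one).le)

theorem resFun_mem_cochains {n m : ℕ} (hnm : n ≤ m) (i : ℕ)
    {φ : (Fin i → powSubgroup p H n) → powSubgroup p H n → W} (hφ : φ ∈ cochains b W n i) :
    resFun p H W hnm i φ ∈ cochains b W m i := by
  obtain ⟨A, hA, hφ⟩ := hφ
  refine ⟨fun g => rescale p (m - n)
    (A fun j => Subgroup.inclusion (powSubgroup_le p H hnm) (g j)), ?_, fun g h => ?_⟩
  · refine (continuous_rescale _).comp (hA.comp (continuous_pi fun j => ?_))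
    exact (continuous_inclusion (powSubgroup_le p H hnm)).comp (continuous_apply j)
  · have := hφ (fun j => Subgroup.inclusion (powSubgroup_le p H hnm) (g j))
      (Subgroup.inclusion (powSubgroup_le p H hnm) h)
    have e : (fun k => monomial b n k (h : H) •
        A (fun j => Subgroup.inclusion (powSubgroup_le p H hnm) (g j)) k) = fun k =>
        monomial b m k (h : H) • rescale p (m - n)
          (A fun j => Subgroup.inclusion (powSubgroup_le p H hnm) (g j)) k := by
      funext k
      rw [monomial_le b hnm, mul_smul]
      rfl
    rw [← e]
    exact this

theorem diff_resFun {H : Type*} [Group H] (ρ : Representation ℚ_[p] H W) {n m : ℕ} (hnm : n ≤ m) (i : ℕ)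
    (φ : (Fin i → powSubgroup p H n) → powSubgroup p H n → W) :
    diff ρ m i (resFun p H W hnm i φ) = resFun p H W hnm (i + 1) (diff ρ n i φ) := by
  have key : ∀ (j : Fin (i + 1)) (g : Fin (i + 1) → powSubgroup p H m),
      (fun l => Subgroup.inclusion (powSubgroup_le p H hnm) (Fin.contractNth j (· * ·) g l)) =
        Fin.contractNth j (· * ·)
          (fun l => Subgroup.inclusion (powSubgroup_le p H hnm) (g l)) := by
    intro j g
    funext l
    unfold Fin.contractNth
    split_ifs <;> simp
  funext g h
  simp [diff, resFun, funRep, key]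

theorem resFun_mem_cocycles (ρ : Representation ℚ_[p] H W) {n m : ℕ} (hnm : n ≤ m) (i : ℕ) :
    cocycles b ρ n i ≤ (cocycles b ρ m i).comap (resFun p H W hnm i) := by
  rintro φ ⟨hφ, hd⟩
  refine ⟨resFun_mem_cochains b hnm i hφ, ?_⟩
  have hd' : diff ρ n i φ = 0 := hd
  change diff ρ m i (resFun p H W hnm i φ) = 0
  rw [diff_resFun, hd', map_zero]

theorem resFun_mem_coboundaries (ρ : Representation ℚ_[p] H W) {n m : ℕ} (hnm : n ≤ m) (i : ℕ) :
    coboundaries b ρ n i ≤ (coboundaries b ρ m i).comap (resFun p H W hnm i) := by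
  cases i with
  | zero => simp [coboundaries]
  | succ i =>
    rintro _ ⟨ψ, hψ, rfl⟩
    exact ⟨resFun p H W hnm i ψ, resFun_mem_cochains b hnm i hψ, diff_resFun ρ hnm i ψ⟩

/-- The transition map `H^i_cont(H_n, 𝒞^an(H_n, W)) → H^i_cont(H_m, 𝒞^an(H_m, W))` for `n ≤ m`,
induced by restriction of cochains. -/
def transition (ρ : Representation ℚ_[p] H W) (i n m : ℕ) (hnm : n ≤ m) :
    Hcont b ρ n i →ₗ[ℚ_[p]] Hcont b ρ m i :=
  Submodule.mapQ _ _ ((resFun p H W hnm i).restrict (resFun_mem_cocycles b ρ hnm i))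
    fun _ hφ => resFun_mem_coboundaries b ρ hnm i hφ

/-- The derived functor `R^i LA(W)`, the direct limit over `n` of
`H^i_cont(H_n, 𝒞^an(H_n, W))`. -/
abbrev RLA (ρ : Representation ℚ_[p] H W) (i : ℕ) : Type _ :=
  Module.DirectLimit (fun n => Hcont b ρ n i) (transition b ρ i)

/-- `W` is LA-acyclic if `R^i LA(W) = 0` for all `i ≥ 1`. -/
def IsLAAcyclic (ρ : Representation ℚ_[p] H W) : Prop :=
  ∀ i, 1 ≤ i → Subsingleton (RLA b ρ i)

/-- `W` is strongly LA-acyclic if for every `i ≥ 1` the direct system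
`H^i_cont(H_n, 𝒞^an(H_n, W))` is essentially zero. -/
def IsStronglyLAAcyclic (ρ : Representation ℚ_[p] H W) : Prop :=
  ∀ i, 1 ≤ i → ∀ n, ∃ (m : ℕ) (hnm : n ≤ m), transition b ρ i n m hnm = 0

end

end LocAn

end

noncomputable section

namespace LocAn

/-! Essential vanishing implies vanishing of the direct limit formally. The converse is a Baire
category argument. Fix `i ≥ 1` and `n`. Since `G_n` is compact, the continuous families of
coefficients on `G_n ^ i` form a Banach space, and those whose cochains are cocycles form a closed
subspace `Z`. If the limit vanishes, each element of `Z` becomes a coboundary at some level `m`. The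
pairs (cocycle in `Z`, cochain at level `m` bounding its restriction) form a Banach space, and `Z`
is the countable union of the images of these spaces under the first projection. By Baire and the
open mapping argument (`exists_surjective_of_iUnion_range`), one projection is onto, so a single `m`
serves all cocycles.

Identities between cochains are compared in spaces of all functions with the product topology, so
pointwise continuity of differentials, restrictions and evaluations suffices. Neither uniqueness of
expansions nor stability of analytic functions under the action is needed.

Evaluation of an expansion at a point of `G_n` is bounded because the monomials have norm at most
`1` there, which means that `p ^ n` divides the coordinates of elements of `G_n` (`pow_dvd_coord`).
This rests on `OrderedBasis.val_gen_le`: all basis elements share the minimal valuation. A basis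
element of larger valuation would be a `p`-th power by saturation. As the `p`-th power map is
additive on graded pieces (`mk_mul_pow`), this would give a relation modulo higher valuation that
the valuation formula of the basis forbids. -/

/-- The power of a product of two elements whose commutator commutes with both of them. -/
theorem mul_pow_of_central_commutator {Q : Type*} [Group Q] {x y c : Q} (h : y * x = x * y * c)
    (hx : Commute c x) (hy : Commute c y) (n : ℕ) :
    (x * y) ^ n = x ^ n * y ^ n * c ^ n.choose 2 := by
  have key : ∀ n : ℕ, y ^ n * x = x * y ^ n * c ^ n := by
    intro n
    induction n with
    | zero => simp
    | succ n ih =>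
      calc y ^ (n + 1) * x = y ^ n * (y * x) := by rw [pow_succ, mul_assoc]
        _ = y ^ n * x * (y * c) := by rw [h]; simp only [mul_assoc]
        _ = x * y ^ n * (c ^ n * y) * c := by rw [ih]; simp only [mul_assoc]
        _ = x * y ^ (n + 1) * c ^ (n + 1) := by
          rw [(hy.pow_left n).eq, pow_succ, pow_succ]; simp only [mul_assoc]
  induction n with
  | zero => simp
  | succ n ih =>
    have hc : Commute (c ^ n.choose 2) (x * y) := (hx.pow_left _).mul_right (hy.pow_left _)
    calc (x * y) ^ (n + 1) = x ^ n * y ^ n * (c ^ n.choose 2 * (x * y)) := by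
          rw [pow_succ, ih, mul_assoc]
      _ = x ^ n * (y ^ n * x) * y * c ^ n.choose 2 := by rw [hc.eq]; simp only [mul_assoc]
      _ = x ^ n * x * y ^ n * (c ^ n * y) * c ^ n.choose 2 := by
          rw [key]; simp only [mul_assoc]
      _ = x ^ (n + 1) * y ^ (n + 1) * c ^ (n + 1).choose 2 := by
          rw [(hy.pow_left n).eq, show (n + 1).choose 2 = n + n.choose 2 by
              rw [Nat.choose_succ_succ' n 1, Nat.choose_one_right],
            pow_add c, pow_succ x, pow_succ y]
          simp only [mul_assoc]

/-! ### The filtration of a `p`-valued group and its `p`-th powers -/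

namespace IsIntegralSaturatedPValuation

variable {p : ℕ} {H : Type*} [Group H] [TopologicalSpace H] {v : H → ℕ∞}


theorem map_one (hv : IsIntegralSaturatedPValuation p v) : v 1 = ⊤ := (hv.eq_top_iff 1).2 rfl

theorem le_inv (hv : IsIntegralSaturatedPValuation p v) (g : H) : v g ≤ v g⁻¹ := by
  simpa [hv.map_one] using hv.min_le_mul_inv 1 g

theorem min_le_mul (hv : IsIntegralSaturatedPValuation p v) (g h : H) : min (v g) (v h) ≤ v (g * h) := by
  have := hv.min_le_mul_inv g h⁻¹
  rw [inv_inv] at this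
  exact (min_le_min le_rfl (hv.le_inv h)).trans this

/-- The subgroup of elements of valuation at least `s`. -/
def levelSubgroup (hv : IsIntegralSaturatedPValuation p v) (s : ℕ∞) : Subgroup H where
  carrier := {g | s ≤ v g}
  mul_mem' {a b} ha hb := (le_min ha hb).trans (hv.min_le_mul a b)
  one_mem' := by simp [hv.map_one]
  inv_mem' {a} ha := le_trans ha (hv.le_inv a)

theorem le_conj (hv : IsIntegralSaturatedPValuation p v) (g h : H) : v h ≤ v (g * h * g⁻¹) := by
  have h1 : v h ≤ v (g * h * g⁻¹ * h⁻¹) := le_add_self.trans (hv.add_le_commutator g h)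
  have h2 := hv.min_le_mul (g * h * g⁻¹ * h⁻¹) h
  rw [inv_mul_cancel_right] at h2
  exact (le_min h1 le_rfl).trans h2

theorem normal_levelSubgroup (hv : IsIntegralSaturatedPValuation p v) (s : ℕ∞) : (hv.levelSubgroup s).Normal :=
  ⟨fun h hh g => le_trans hh (hv.le_conj g h)⟩

theorem map_pow_pow (hv : IsIntegralSaturatedPValuation p v) (g : H) (n : ℕ) : v (g ^ p ^ n) = v g + n := by
  induction n with
  | zero => simp
  | succ n ih => rw [pow_succ, pow_mul, hv.map_pow, ih]; push_cast; rw [add_assoc]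

theorem pow_mem_levelSubgroup_of_dvd (hv : IsIntegralSaturatedPValuation p v) {a m : ℕ} (h : p ^ a ∣ m) (g : H) :
    g ^ m ∈ hv.levelSubgroup (v g + a) := by
  obtain ⟨u, rfl⟩ := h
  rw [pow_mul]
  exact pow_mem (hv.map_pow_pow g a).ge u

theorem one_le (hv : IsIntegralSaturatedPValuation p v) (g : H) : 1 ≤ v g := by
  rw [Order.one_le_iff_ne_zero]
  intro h
  simpa [h] using hv.one_lt g

/-- Saturation is applied `n` times, each root lowering the valuation by one. The bound `3` keeps
every step admissible, since `p < 3 (p - 1)` for all primes, including `2`. -/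
theorem exists_pow_eq (hv : IsIntegralSaturatedPValuation p v) (hp : p.Prime) (n : ℕ) (g : H) (hg : (n : ℕ∞) + 3 ≤ v g) :
    ∃ h, h ^ p ^ n = g := by
  induction n generalizing g with
  | zero => exact ⟨g, by simp⟩
  | succ n ih =>
    have h2 := hp.two_le
    obtain ⟨h, rfl⟩ := hv.saturated g (by
      have h3 : (3 : ℕ∞) ≤ v g := le_add_self.trans hg
      refine lt_of_lt_of_le ?_ (mul_le_mul_right h3 _)
      norm_cast
      obtain ⟨q, rfl⟩ := Nat.exists_eq_add_of_le h2
      omega)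
    rw [hv.map_pow] at hg
    obtain ⟨k, rfl⟩ := ih h (by
      refine (ENat.add_le_add_iff_right (k := 1) (by simp)).1 ?_
      refine le_trans (le_of_eq ?_) hg
      push_cast
      ring)
    exact ⟨k, by rw [pow_succ, pow_mul]⟩

theorem commute_mk (hv : IsIntegralSaturatedPValuation p v) {s t u : ℕ∞} [(hv.levelSubgroup u).Normal] (hu : u ≤ s + t) {x y : H} (hx : s ≤ v x)
    (hy : t ≤ v y) : Commute (x : H ⧸ hv.levelSubgroup u) (y : H ⧸ hv.levelSubgroup u) := by
  have h : ((x * y * x⁻¹ * y⁻¹ : H) : H ⧸ hv.levelSubgroup u) = 1 :=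
    (QuotientGroup.eq_one_iff _).2
      (hu.trans ((add_le_add hx hy).trans (hv.add_le_commutator x y)))
  simp only [QuotientGroup.mk_mul, QuotientGroup.mk_inv] at h
  exact mul_inv_eq_iff_eq_mul.1 (mul_inv_eq_one.1 h)

/-- The `p`-th power map is additive on the graded pieces. -/
theorem mk_mul_pow (hv : IsIntegralSaturatedPValuation p v) (hp : p.Prime) {t : ℕ} (ht : 1 < (p - 1) * t)
    [(hv.levelSubgroup (t + 2)).Normal]
    {x y : H} (hx : t ≤ v x) (hy : t ≤ v y) :
    ((x * y : H) : H ⧸ hv.levelSubgroup (t + 2)) ^ p =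
      (x : H ⧸ hv.levelSubgroup (t + 2)) ^ p * (y : H ⧸ hv.levelSubgroup (t + 2)) ^ p := by
  have ht1 : 1 ≤ t := by
    rcases Nat.eq_zero_or_pos t with rfl | h
    · simp at ht
    · exact h
  -- The commutator `c` has valuation at least `2t`, so its commutators with `x` and `y` have
  -- valuation at least `3t`, and `c` commutes with both modulo level `t + 2`.
  have h3 : (t : ℕ∞) + 2 ≤ t + t + t := by norm_cast; omega
  set c : H := y⁻¹ * x⁻¹ * y * x with hc
  have hvc : (t + t : ℕ∞) ≤ v c := by
    have := hv.add_le_commutator y⁻¹ x⁻¹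
    simp only [inv_inv] at this
    exact (add_le_add (hy.trans (hv.le_inv y)) (hx.trans (hv.le_inv x))).trans this
  rw [QuotientGroup.mk_mul, mul_pow_of_central_commutator
    (c := (c : H ⧸ hv.levelSubgroup (t + 2))) ?_ (hv.commute_mk h3 hvc hx)
    (hv.commute_mk h3 hvc hy)]
  · rw [← QuotientGroup.mk_pow, ← QuotientGroup.mk_pow, ← QuotientGroup.mk_pow,
      (QuotientGroup.eq_one_iff (c ^ p.choose 2)).2, mul_one]
    -- The error term `c ^ (p.choose 2)` dies for two reasons: for `p = 2` the exponent is `1` but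
    -- `ht` forces `t ≥ 2`; for odd `p` the exponent is divisible by `p`, which gains one.
    rcases hp.eq_two_or_odd' with rfl | hodd
    · have h2 : (t : ℕ∞) + 2 ≤ t + t := by norm_cast; omega
      exact pow_mem (show c ∈ hv.levelSubgroup (t + 2) from h2.trans hvc) _
    · have hlt : 2 < p := lt_of_le_of_ne hp.two_le (by rintro rfl; exact absurd hodd (by decide))
      have h2 : (t : ℕ∞) + 2 ≤ t + t + 1 := by norm_cast; omega
      have hd : p ^ 1 ∣ p.choose 2 := by
        rw [pow_one]; exact hp.dvd_choose_self two_ne_zero hlt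
      have := hv.pow_mem_levelSubgroup_of_dvd hd c
      refine h2.trans (le_trans ?_ this)
      push_cast
      gcongr
  · rw [← QuotientGroup.mk_mul, ← QuotientGroup.mk_mul, ← QuotientGroup.mk_mul]
    congr 1
    rw [hc]
    group

theorem mk_list_prod_pow (hv : IsIntegralSaturatedPValuation p v) (hp : p.Prime) {t : ℕ} (ht : 1 < (p - 1) * t)
    [(hv.levelSubgroup (t + 2)).Normal]
    (l : List H) (hl : ∀ x ∈ l, (t : ℕ∞) ≤ v x) :
    ((l.prod : H) : H ⧸ hv.levelSubgroup (t + 2)) ^ p =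
      (l.map fun x : H => (x : H ⧸ hv.levelSubgroup (t + 2)) ^ p).prod := by
  induction l with
  | nil => simp
  | cons a l ih =>
    rw [List.forall_mem_cons] at hl
    rw [List.prod_cons, hv.mk_mul_pow hp ht hl.1
      (list_prod_mem (S := hv.levelSubgroup t) hl.2), ih hl.2, List.map_cons, List.prod_cons]

end IsIntegralSaturatedPValuation

/-! ### Valuations of the elements of an ordered basis -/

namespace OrderedBasis

variable {p : ℕ} [Fact p.Prime] {H : Type*} [Group H] [TopologicalSpace H]
  {v : H → ℕ∞} {d : ℕ} (b : OrderedBasis p v d)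

theorem gen_ne_one (i : Fin d) : b.gen i ≠ 1 := by
  intro h
  have h1 := b.coord_natCast (Pi.single i 1)
  have h0 := b.coord_natCast 0
  have e : (fun j => b.gen j ^ (Pi.single i 1 : Fin d → ℕ) j) =
      fun j => b.gen j ^ (0 : Fin d → ℕ) j := by
    funext j
    rcases eq_or_ne j i with rfl | hj
    · simp [h]
    · simp [Pi.single_eq_of_ne hj]
  rw [e, ← h0] at h1
  simpa using congrFun (b.coord.injective h1) i

theorem val_gen_ne_top (hv : IsIntegralSaturatedPValuation p v) (i : Fin d) : v (b.gen i) ≠ ⊤ :=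
  fun h => b.gen_ne_one i ((hv.eq_top_iff _).1 h)

/-- The valuation of the product is the minimum over its factors, so the `p`-adic valuation of each
exponent must make up for the deficit `t - v (gen i)`; the subtraction is truncated when there is
none. -/
theorem le_val_gen_pow (hv : IsIntegralSaturatedPValuation p v) {t : ℕ} (k : Fin d → ℕ)
    (hk : (t : ℕ∞) ≤ v (b.coord fun i => (k i : ℤ_[p]))) (i : Fin d) :
    (t : ℕ∞) ≤ v (b.gen i ^ k i) := by
  obtain ⟨s, hs⟩ := ENat.ne_top_iff_exists.1 (b.val_gen_ne_top hv i)
  rw [b.val_coord] at hk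
  have h1 := hk.trans (iInf_le _ i)
  rw [← hs] at h1
  have h2 : ((t - s : ℕ) : ℕ∞) ≤ emultiplicity (p : ℤ_[p]) (k i) := by
    rw [ENat.natCast_sub]
    exact tsub_le_iff_left.2 h1
  rw [← pow_dvd_iff_le_emultiplicity] at h2
  have h3 : p ^ (t - s) ∣ k i := by
    have := (PadicInt.pow_p_dvd_int_iff (t - s) (k i : ℤ)).1 (by simpa using h2)
    exact_mod_cast this
  refine le_trans ?_ (hv.pow_mem_levelSubgroup_of_dvd h3 (b.gen i))
  rw [← hs]
  norm_cast
  omega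

/-- With an integer valued saturated `p`-valuation, all elements of an ordered basis have the
minimal valuation. -/
theorem val_gen_le [IsTopologicalGroup H] (hv : IsIntegralSaturatedPValuation p v) (i : Fin d)
    (g : H) : v (b.gen i) ≤ v g := by
  have hp : p.Prime := Fact.out
  by_contra! hlt
  obtain ⟨s, hs⟩ := ENat.ne_top_iff_exists.1 (b.val_gen_ne_top hv i)
  obtain ⟨r, hr⟩ := ENat.ne_top_iff_exists.1 hlt.ne_top
  have hg := hv.one_lt g
  rw [← hs, ← hr] at hlt
  rw [← hr] at hg
  norm_cast at hlt hg
  -- By integrality `(p - 1) v(g) ≥ 2`, and `v (b.gen i) ≥ v g + 1`, hence `(p - 1) v (b.gen i) ≥ p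
  -- + 1`.
  obtain ⟨h, hh⟩ := hv.saturated (b.gen i) (by
    rw [← hs]
    norm_cast
    have h2 := hp.two_le
    have := Nat.mul_le_mul_left (p - 1) (Nat.succ_le_of_lt hlt)
    rw [Nat.mul_succ] at this
    omega)
  have hvh := hv.map_pow h
  rw [hh, ← hs] at hvh
  obtain ⟨t, ht⟩ := ENat.ne_top_iff_exists.1 (show v h ≠ ⊤ by
    intro e; rw [e] at hvh; simp at hvh)
  have ht1 := hv.one_lt h
  rw [← ht] at hvh ht1
  norm_cast at hvh ht1
  have ht0 : 1 ≤ t := by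
    rcases Nat.eq_zero_or_pos t with rfl | h
    · simp at ht1
    · exact h
  subst hvh
  have := hv.normal_levelSubgroup (t + 2)
  -- approximate `h` by a product of natural powers of the generators
  obtain ⟨k, hk⟩ : ∃ k : Fin d → ℕ,
      ((t + 1 : ℕ) : ℕ∞) ≤ v ((b.coord fun i => (k i : ℤ_[p]))⁻¹ * h) := by
    have hd : DenseRange (fun (k : Fin d → ℕ) (i : Fin d) => (k i : ℤ_[p])) :=
      DenseRange.piMap fun _ => PadicInt.denseRange_natCast
    have hn : {x : Fin d → ℤ_[p] | ((t + 1 : ℕ) : ℕ∞) ≤ v ((b.coord x)⁻¹ * h)} ∈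
        nhds (b.coord.symm h) := by
      have hc : Continuous fun x => (b.coord x)⁻¹ * h := by fun_prop
      have := hc.tendsto (b.coord.symm h)
      simp only [Homeomorph.apply_symm_apply, inv_mul_cancel] at this
      exact this (hv.nhds_one.mem_of_mem trivial)
    obtain ⟨_, hx, k, rfl⟩ := mem_closure_iff_nhds.1 (hd (b.coord.symm h)) _ hn
    exact ⟨k, hx⟩
  set y : H := (b.coord fun i => (k i : ℤ_[p]))⁻¹ * h with hy
  have hxy : h = (b.coord fun i => (k i : ℤ_[p])) * y := by simp [hy]
  have hvy : (t : ℕ∞) ≤ v y := le_trans (by norm_cast; omega) hk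
  have hvx : (t : ℕ∞) ≤ v (b.coord fun i => (k i : ℤ_[p])) := by
    have := hv.min_le_mul_inv h y
    rw [hy, mul_inv_rev, inv_inv, mul_inv_cancel_left, ← hy, ← ht] at this
    exact (le_min le_rfl hvy).trans this
  set π := QuotientGroup.mk' (hv.levelSubgroup (t + 2)) with hπ
  have hπ1 : ∀ x : H, π x = 1 ↔ (t : ℕ∞) + 2 ≤ v x := fun x => QuotientGroup.eq_one_iff x
  -- All valuations are at least `1`, so commutators with an element of level `t + 1` lie in level
  -- `t + 2`.
  have hcentral : ∀ x : H, ((t + 1 : ℕ) : ℕ∞) ≤ v x → π x ∈ Submonoid.center _ := by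
    intro x hx
    rw [Submonoid.mem_center_iff]
    intro q
    obtain ⟨q, rfl⟩ := QuotientGroup.mk'_surjective _ q
    have h12 : (t : ℕ∞) + 2 ≤ 1 + (t + 1 : ℕ) := by norm_cast; omega
    exact hv.commute_mk h12 (hv.one_le q) hx
  have hgenk := b.le_val_gen_pow hv k hvx
  -- The factors live in the center, a commutative monoid, so the ordered product may be rearranged.
  let z : Fin d → Submonoid.center (H ⧸ hv.levelSubgroup (t + 2)) := fun j =>
    ⟨π ((b.gen j ^ k j) ^ p), hcentral _ (by
      rw [hv.map_pow]; push_cast; gcongr; exact hgenk j)⟩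
  let w : Submonoid.center (H ⧸ hv.levelSubgroup (t + 2)) :=
    ⟨π (b.gen i), hcentral _ hs.le⟩
  have hyp : π (y ^ p) = 1 := by
    rw [hπ1, hv.map_pow]
    calc (t : ℕ∞) + 2 = ((t + 1 : ℕ) : ℕ∞) + 1 := by push_cast; ring
      _ ≤ _ := by gcongr
  have hw : (∏ j, z j) = w := by
    apply Subtype.ext
    change _ = π (b.gen i)
    rw [← hh, hxy]
    change _ = ((_ * y : H) : H ⧸ hv.levelSubgroup (t + 2)) ^ p
    rw [hv.mk_mul_pow Fact.out ht1 hvx hvy]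
    change _ = _ * π (y ^ p)
    rw [hyp, mul_one, b.coord_natCast, hv.mk_list_prod_pow Fact.out ht1 _ (by
      intro x hx
      obtain ⟨j, rfl⟩ := List.mem_ofFn.1 hx
      exact hgenk j), List.map_ofFn, ← List.prod_ofFn]
    change Submonoid.subtype _ _ = _
    rw [map_list_prod, List.map_ofFn]
    rfl
  have hwp : w ^ p = 1 := by
    apply Subtype.ext
    change π (b.gen i ^ p) = 1
    rw [hπ1, hv.map_pow, ← hs]
    norm_cast
  -- Modulo level `t + 2`, `b.gen i` is the product of the `b.gen j ^ (k j * p)`. Multiplying by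
  -- `b.gen i ^ (p - 1)` gives `b.gen i ^ p`, which is trivial there; yet the `i`-th exponent is
  -- `-1` modulo `p`, so the valuation formula bounds the valuation by `t + 1`.
  let k' : Fin d → ℕ := fun j => k j * p + if j = i then p - 1 else 0
  have hk' : π (b.coord fun i => (k' i : ℤ_[p])) = 1 := by
    have e : ∀ j, π (b.gen j ^ k' j) =
        ((z j * if j = i then w ^ (p - 1) else 1 : Submonoid.center _) :
          H ⧸ hv.levelSubgroup (t + 2)) := by
      intro j
      simp only [k', pow_add, pow_mul]
      split_ifs with hj
      · subst hj; rfl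
      · simp [z]
    rw [b.coord_natCast, map_list_prod, List.map_ofFn]
    have e' : (π ∘ fun j => b.gen j ^ k' j) = Submonoid.subtype _ ∘ fun j =>
      z j * if j = i then w ^ (p - 1) else 1 := funext e
    rw [e', ← List.map_ofFn, ← map_list_prod, List.prod_ofFn, Finset.prod_mul_distrib, hw,
      Finset.prod_ite_eq' Finset.univ i, if_pos (Finset.mem_univ i), mul_pow_sub_one hp.ne_zero,
      hwp, map_one]
  rw [hπ1, b.val_coord] at hk'
  have h1 := hk'.trans (iInf_le _ i)
  have h2 : emultiplicity (p : ℤ_[p]) (k' i) = 0 := by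
    rw [emultiplicity_eq_zero]
    intro hdvd
    have : p ∣ k' i := by
      have := (PadicInt.pow_p_dvd_int_iff (p := p) 1 (k' i : ℤ)).1 (by simpa using hdvd)
      rw [pow_one] at this
      exact_mod_cast this
    simp only [k', if_true] at this
    rw [Nat.dvd_add_right (dvd_mul_left p (k i))] at this
    exact absurd (Nat.le_of_dvd (Nat.sub_pos_of_lt hp.one_lt) this) (by have := hp.two_le; omega)
  rw [h2, ← hs, add_zero] at h1
  norm_cast at h1
  omega

end OrderedBasis

/-! ### Coordinates and compactness of the subgroups `H_n` -/

section

variable {p : ℕ} [Fact p.Prime] {H : Type*} [Group H] [TopologicalSpace H]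
  {v : H → ℕ∞} {d : ℕ} (b : OrderedBasis p v d)

/-- Elements of `H_n` have valuation at least the minimal one plus `n`. Each `b.gen i` attains that
minimum, so the excess `n` must come from the coordinate. -/
theorem pow_dvd_coord [IsTopologicalGroup H] (hv : IsIntegralSaturatedPValuation p v) (n : ℕ)
    {h : H} (hh : h ∈ powSubgroup p H n) (i : Fin d) :
    (p : ℤ_[p]) ^ n ∣ b.coord.symm h i := by
  have hle : powSubgroup p H n ≤ hv.levelSubgroup (v (b.gen i) + n) := by
    refine (Subgroup.closure_le _).2 ?_
    rintro _ ⟨g, rfl⟩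
    change _ ≤ v (g ^ p ^ n)
    rw [hv.map_pow_pow]
    gcongr
    exact b.val_gen_le hv i g
  have h1 : v (b.gen i) + n ≤ v h := hle hh
  have h2 := b.val_coord (b.coord.symm h)
  rw [Homeomorph.apply_symm_apply] at h2
  rw [h2] at h1
  rw [pow_dvd_iff_le_emultiplicity]
  exact (ENat.add_le_add_iff_left (b.val_gen_ne_top hv i)).1 (h1.trans (iInf_le _ i))

theorem norm_monomial_le_one [IsTopologicalGroup H] (hv : IsIntegralSaturatedPValuation p v)
    (n : ℕ) (k : Fin d → ℕ) (h : powSubgroup p H n) : ‖monomial b n k (h : H)‖ ≤ 1 := by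
  have hp : (p : ℚ_[p]) ≠ 0 := by exact_mod_cast (Fact.out : p.Prime).ne_zero
  unfold monomial
  rw [norm_prod]
  refine Finset.prod_le_one (fun _ _ => norm_nonneg _) fun i _ => ?_
  rw [norm_pow]
  refine pow_le_one₀ (norm_nonneg _) ?_
  obtain ⟨y, hy⟩ := pow_dvd_coord b hv n h.2 i
  rw [hy]
  push_cast
  rw [mul_div_cancel_left₀ _ (pow_ne_zero _ hp)]
  exact y.2

/-- The subgroup is open, because every element of valuation at least `n + 3` is a `p ^ n`-th power.
-/
theorem isClosed_powSubgroup [IsTopologicalGroup H] (hv : IsIntegralSaturatedPValuation p v)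
    (n : ℕ) : IsClosed (powSubgroup p H n : Set H) := by
  refine Subgroup.isClosed_of_isOpen _ (Subgroup.isOpen_of_mem_nhds _ (g := 1) ?_)
  refine Filter.mem_of_superset (hv.nhds_one.mem_of_mem (i := n + 3) trivial) fun g hg => ?_
  obtain ⟨h, rfl⟩ := hv.exists_pow_eq Fact.out n g (by exact_mod_cast hg)
  exact Subgroup.subset_closure ⟨h, rfl⟩

theorem compactSpace_powSubgroup (b : OrderedBasis p v d) [IsTopologicalGroup H]
    (hv : IsIntegralSaturatedPValuation p v) (n : ℕ) : CompactSpace (powSubgroup p H n) := by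
  have : CompactSpace H := b.coord.compactSpace
  exact isCompact_iff_compactSpace.1 (isClosed_powSubgroup hv n).isCompact

end

end LocAn
end

noncomputable section

namespace LocAn

/-! ### A Baire category form of the open mapping theorem -/

section OpenMapping

open Metric Filter Set

variable {𝕜 : Type*} [NontriviallyNormedField 𝕜]
  {F : Type*} [NormedAddCommGroup F] [NormedSpace 𝕜 F]

/-- If a bounded linear map on a Banach space approximates every vector up to half of its norm
with control of the norm, then it is onto. -/
theorem surjective_of_approx_preimage {E : Type*} [NormedAddCommGroup E] [NormedSpace 𝕜 E]
    [CompleteSpace E] (f : E →L[𝕜] F) {C : ℝ}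
    (hC : ∀ y, ∃ x, ‖y - f x‖ ≤ 1 / 2 * ‖y‖ ∧ ‖x‖ ≤ C * ‖y‖) : Function.Surjective f := by
  intro y
  choose g hg using hC
  -- Successive approximation: the remainders shrink geometrically, so the corrections sum to a
  -- preimage.
  let r : F → F := fun z => z - f (g z)
  have hr : ∀ n : ℕ, ‖r^[n] y‖ ≤ (1 / 2) ^ n * ‖y‖ := by
    intro n
    induction n with
    | zero => simp
    | succ n ih =>
      rw [Function.iterate_succ_apply']
      refine (hg _).1.trans ?_
      rw [pow_succ', mul_assoc]
      gcongr
  have hsum : Summable fun n => g (r^[n] y) := by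
    refine Summable.of_norm_bounded (g := fun n : ℕ => (1 / 2 : ℝ) ^ n * (|C| * ‖y‖))
      ((summable_geometric_of_lt_one (by norm_num) (by norm_num)).mul_right _) fun n => ?_
    calc ‖g (r^[n] y)‖ ≤ C * ‖r^[n] y‖ := (hg _).2
      _ ≤ |C| * ((1 / 2) ^ n * ‖y‖) := by
        gcongr
        · exact le_abs_self C
        · exact hr n
      _ = _ := by ring
  have hpart : ∀ n : ℕ, f (∑ i ∈ Finset.range n, g (r^[i] y)) = y - r^[n] y := by
    intro n
    induction n with
    | zero => simp
    | succ n ih =>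
      rw [Finset.sum_range_succ, map_add, ih, Function.iterate_succ_apply']
      simp only [r]
      abel
  have hlim := (f.continuous.tendsto _).comp hsum.hasSum.tendsto_sum_nat
  have h0 : Tendsto (fun n => r^[n] y) atTop (nhds 0) := by
    refine squeeze_zero_norm hr ?_
    simpa using (tendsto_pow_atTop_nhds_zero_of_lt_one (r := (1 / 2 : ℝ)) (by norm_num)
      (by norm_num)).mul_const ‖y‖
  have hlim' : Tendsto (fun n => y - r^[n] y) atTop (nhds (y - 0)) := tendsto_const_nhds.sub h0
  refine ⟨_, (tendsto_nhds_unique hlim ?_).trans (sub_zero y)⟩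
  exact hlim'.congr fun n => (hpart n).symm

/-- If a Banach space is the union of the ranges of countably many bounded linear maps from
Banach spaces, then one of these maps is onto. -/
theorem exists_surjective_of_iUnion_range {ι : Type*} [Countable ι] {E : ι → Type*}
    [∀ i, NormedAddCommGroup (E i)] [∀ i, NormedSpace 𝕜 (E i)] [∀ i, CompleteSpace (E i)]
    [CompleteSpace F] (f : ∀ i, E i →L[𝕜] F) (hf : ∀ y, ∃ i x, f i x = y) :
    ∃ i, Function.Surjective (f i) := by
  obtain ⟨⟨i, n⟩, a, ha⟩ : ∃ q : ι × ℕ, (interior (closure (f q.1 '' ball 0 q.2))).Nonempty := by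
    refine nonempty_interior_of_iUnion_of_closed (fun _ => isClosed_closure) ?_
    refine eq_univ_of_forall fun y => ?_
    obtain ⟨i, x, rfl⟩ := hf y
    obtain ⟨n, hn⟩ := exists_nat_gt ‖x‖
    exact mem_iUnion.2 ⟨(i, n), subset_closure ⟨x, by simpa using hn, rfl⟩⟩
  simp only [mem_interior_iff_mem_nhds, Metric.mem_nhds_iff] at ha
  obtain ⟨ε, εpos, hε⟩ := ha
  refine ⟨i, ?_⟩
  -- every vector close to `0` is a limit of images of vectors of norm at most `2 n`
  have near : ∀ z : F, ‖z‖ < ε → ∀ δ > 0, ∃ x : E i, ‖f i x - z‖ < δ ∧ ‖x‖ ≤ 2 * n := by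
    intro z hz δ hδ
    obtain ⟨_, ⟨x₁, hx₁, rfl⟩, h₁⟩ := Metric.mem_closure_iff.1
      (hε (show a + z ∈ ball a ε by simpa [dist_eq_norm] using hz)) _ (half_pos hδ)
    obtain ⟨_, ⟨x₂, hx₂, rfl⟩, h₂⟩ := Metric.mem_closure_iff.1
      (hε (mem_ball_self εpos)) _ (half_pos hδ)
    rw [mem_ball_zero_iff] at hx₁ hx₂
    refine ⟨x₁ - x₂, ?_, ?_⟩
    -- Subtracting the approximations of `a + z` and `a` removes the unknown centre `a`.
    · rw [dist_comm, dist_eq_norm] at h₁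
      rw [dist_eq_norm] at h₂
      calc ‖f i (x₁ - x₂) - z‖ = ‖(f i x₁ - (a + z)) + (a - f i x₂)‖ := by
            rw [map_sub]; congr 1; abel
        _ ≤ _ := norm_add_le _ _
        _ < δ := by linarith
    · calc ‖x₁ - x₂‖ ≤ ‖x₁‖ + ‖x₂‖ := norm_sub_le _ _
        _ ≤ 2 * n := by linarith
  obtain ⟨c, hc⟩ := NormedField.exists_one_lt_norm 𝕜
  refine surjective_of_approx_preimage (f i) (C := (ε⁻¹ * ‖c‖) * (2 * n)) fun y => ?_
  rcases eq_or_ne y 0 with rfl | hy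
  · exact ⟨0, by simp⟩
  obtain ⟨e, he, hlt, -, hinv⟩ := rescale_to_shell hc εpos hy
  have hepos : 0 < ‖e‖ := norm_pos_iff.2 he
  obtain ⟨x, hx, hxn⟩ := near (e • y) hlt (‖e‖ * (1 / 2 * ‖y‖)) (by positivity)
  refine ⟨e⁻¹ • x, ?_, ?_⟩
  · have : y - f i (e⁻¹ • x) = -(e⁻¹ • (f i x - e • y)) := by
      rw [map_smul, smul_sub, inv_smul_smul₀ he, neg_sub]
    rw [this, norm_neg, norm_smul, norm_inv, inv_mul_le_iff₀ hepos]
    exact hx.le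
  · rw [norm_smul, norm_inv]
    calc ‖e‖⁻¹ * ‖x‖ ≤ (ε⁻¹ * ‖c‖ * ‖y‖) * (2 * n) := by gcongr
      _ = _ := by ring

/-- If every `x` of a Banach space satisfies one of countably many conditions `L i x ∈ range (D i)`,
where the `D i` are defined on Banach spaces, then all `x` satisfy the same one of them. -/
theorem exists_forall_mem_range {ι : Type*} [Countable ι] {E Y : ι → Type*}
    [∀ i, NormedAddCommGroup (E i)] [∀ i, NormedSpace 𝕜 (E i)] [∀ i, CompleteSpace (E i)]
    [∀ i, AddCommGroup (Y i)] [∀ i, Module 𝕜 (Y i)] [∀ i, TopologicalSpace (Y i)]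
    [∀ i, T1Space (Y i)] [∀ i, IsTopologicalAddGroup (Y i)] [CompleteSpace F]
    (L : ∀ i, F →L[𝕜] Y i) (D : ∀ i, E i →L[𝕜] Y i) (h : ∀ x, ∃ i y, D i y = L i x) :
    ∃ i, ∀ x, ∃ y, D i y = L i x := by
  -- The kernel of `K i` is the fibre product of `L i` and `D i`; it is closed since points of `Y i`
  -- are closed, hence a Banach space.
  let K : ∀ i, (F × E i) →L[𝕜] Y i := fun i =>
    (L i).comp (ContinuousLinearMap.fst 𝕜 F (E i)) - (D i).comp (ContinuousLinearMap.snd 𝕜 F (E i))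
  have (i : ι) : CompleteSpace (K i).ker :=
    (isClosed_singleton.preimage (K i).continuous).completeSpace_coe
  obtain ⟨i, hi⟩ := exists_surjective_of_iUnion_range
    (fun i => (ContinuousLinearMap.fst 𝕜 F (E i)).comp (K i).ker.subtypeL) fun x => by
      obtain ⟨i, y, e⟩ := h x
      exact ⟨i, ⟨(x, y), sub_eq_zero.2 e.symm⟩, rfl⟩
  refine ⟨i, fun x => ?_⟩
  obtain ⟨⟨⟨x', y⟩, hxy⟩, rfl⟩ := hi x
  exact ⟨y, (sub_eq_zero.1 hxy).symm⟩

end OpenMapping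

/-! ### Banach spaces of cochains and the two implications -/

section

variable {p : ℕ} [Fact p.Prime] {H : Type*} [Group H] [TopologicalSpace H]
  [IsTopologicalGroup H] {v : H → ℕ∞} {d : ℕ} (b : OrderedBasis p v d)
  (hv : IsIntegralSaturatedPValuation p v)
  (W : Type*) [NormedAddCommGroup W] [NormedSpace ℚ_[p] W] [IsUltrametricDist W]

theorem norm_monomial_smul_le (hv : IsIntegralSaturatedPValuation p v) {W : Type*}
    [NormedAddCommGroup W] [NormedSpace ℚ_[p] W] (n : ℕ) (h : powSubgroup p H n)
    (k : Fin d → ℕ) (x : W) : ‖monomial b n k (h : H) • x‖ ≤ ‖x‖ := by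
  rw [norm_smul]
  exact mul_le_of_le_one_left (norm_nonneg _) (norm_monomial_le_one b hv n k h)

theorem norm_apply_le {W : Type*} [NormedAddCommGroup W] (a : C₀(Fin d → ℕ, W)) (k : Fin d → ℕ) :
    ‖a k‖ ≤ ‖a‖ := by
  rw [← ZeroAtInftyContinuousMap.norm_toBCF_eq_norm]
  exact a.toBCF.norm_coe_le_norm k

theorem summable_expansion (hv : IsIntegralSaturatedPValuation p v) {W : Type*}
    [NormedAddCommGroup W] [NormedSpace ℚ_[p] W] [IsUltrametricDist W] [CompleteSpace W] (n : ℕ)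
    (h : powSubgroup p H n) (a : C₀(Fin d → ℕ, W)) :
    Summable fun k => monomial b n k (h : H) • a k := by
  refine NonarchimedeanAddGroup.summable_of_tendsto_cofinite_zero ?_
  refine squeeze_zero_norm (fun k => norm_monomial_smul_le b hv n h k (a k)) ?_
  have := a.zero_at_infty'
  rw [Filter.cocompact_eq_cofinite] at this
  exact tendsto_zero_iff_norm_tendsto_zero.1 this

/-- The value at `h` of the analytic function with given coefficients. -/
def evalExpansion [CompleteSpace W] (n : ℕ) (h : powSubgroup p H n) :
    C₀(Fin d → ℕ, W) →L[ℚ_[p]] W :=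
  LinearMap.mkContinuous
    { toFun := fun a => ∑' k, monomial b n k (h : H) • a k
      map_add' := fun a a' => by
        rw [← (summable_expansion b hv n h a).tsum_add (summable_expansion b hv n h a')]
        simp [smul_add]
      map_smul' := fun c a => by
        rw [RingHom.id_apply, ← (summable_expansion b hv n h a).tsum_const_smul]
        simp [smul_comm c] } 1 fun a => by
    rw [one_mul]
    refine IsUltrametricDist.norm_tsum_le_of_forall_le_of_nonneg (norm_nonneg a) fun k => ?_
    exact (norm_monomial_smul_le b hv n h k (a k)).trans (norm_apply_le a k)

theorem hasExpansion_iff [CompleteSpace W] (n : ℕ) (f : powSubgroup p H n → W)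
    (a : C₀(Fin d → ℕ, W)) :
    HasExpansion b n f a ↔ ∀ h, evalExpansion b hv W n h a = f h := by
  refine forall_congr' fun h => ?_
  exact ⟨fun hs => hs.tsum_eq, fun e => e ▸ (summable_expansion b hv n h a).hasSum⟩

/-- The cochain with values in functions given by a continuous family of coefficients. -/
def toCochain [CompleteSpace W] (n i : ℕ) :
    C(Fin i → powSubgroup p H n, C₀(Fin d → ℕ, W)) →ₗ[ℚ_[p]]
      ((Fin i → powSubgroup p H n) → powSubgroup p H n → W) where
  toFun A g h := evalExpansion b hv W n h (A g)
  map_add' A B := by funext g h; simp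
  map_smul' c A := by funext g h; simp

theorem mem_cochains_iff [CompleteSpace W] (n i : ℕ)
    (φ : (Fin i → powSubgroup p H n) → powSubgroup p H n → W) :
    φ ∈ cochains b W n i ↔ ∃ A, toCochain b hv W n i A = φ := by
  constructor
  · rintro ⟨A, hA, h⟩
    exact ⟨⟨A, hA⟩, funext fun g => funext fun x => (hasExpansion_iff b hv W n _ _).1 (h g) x⟩
  · rintro ⟨A, rfl⟩
    exact ⟨A, A.continuous, fun g => (hasExpansion_iff b hv W n _ _).2 fun _ => rfl⟩

theorem continuous_toCochain [CompleteSpace W] (n i : ℕ) :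
    Continuous (toCochain b hv W n i) := by
  refine continuous_pi fun g => continuous_pi fun h => ?_
  exact (evalExpansion b hv W n h).continuous.comp (ContinuousEvalConst.continuous_eval_const g)

theorem continuous_diff {H W : Type*} [Group H] [NormedAddCommGroup W] [NormedSpace ℚ_[p] W]
    (ρ : Representation ℚ_[p] H W) (hρ : ∀ g, Continuous (ρ g)) (n i : ℕ) :
    Continuous (diff ρ n i) := by
  refine continuous_pi fun g => continuous_pi fun h => ?_
  simp only [diff, funRep, LinearMap.coe_mk, AddHom.coe_mk, MonoidHom.coe_mk, OneHom.coe_mk,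
    Pi.add_apply, Finset.sum_apply, Pi.smul_apply]
  refine Continuous.add ?_ (continuous_finsetSum _ fun j _ => ?_)
  · exact (hρ _).comp (continuous_apply_apply _ _)
  · exact (continuous_apply_apply _ _).const_smul _

theorem continuous_resFun {H W : Type*} [Group H] [NormedAddCommGroup W] [NormedSpace ℚ_[p] W]
    {n m : ℕ} (hnm : n ≤ m) (i : ℕ) : Continuous (resFun p H W hnm i) :=
  continuous_pi fun _ => continuous_pi fun _ => continuous_apply_apply _ _

theorem transition_mk {H : Type*} [Group H] [TopologicalSpace H] {v : H → ℕ∞}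
    (b : OrderedBasis p v d) {W : Type*} [NormedAddCommGroup W] [NormedSpace ℚ_[p] W]
    (ρ : Representation ℚ_[p] H W) {i n m : ℕ} (hnm : n ≤ m) (z : cocycles b ρ n i) :
    transition b ρ i n m hnm (Submodule.Quotient.mk z) = 0 ↔
      resFun p H W hnm i z ∈ coboundaries b ρ m i :=
  Submodule.Quotient.mk_eq_zero ((coboundaries b ρ m i).submoduleOf (cocycles b ρ m i))
    (x := (resFun p H W hnm i).restrict (resFun_mem_cocycles b ρ hnm i) z)

instance directedSystem_transition {H : Type*} [Group H] [TopologicalSpace H] {v : H → ℕ∞}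
    (b : OrderedBasis p v d) {W : Type*} [NormedAddCommGroup W] [NormedSpace ℚ_[p] W]
    (ρ : Representation ℚ_[p] H W) (i : ℕ) :
    DirectedSystem (fun n => Hcont b ρ n i) fun n m h => transition b ρ i n m h where
  map_self n x := by
    obtain ⟨z, rfl⟩ := Submodule.Quotient.mk_surjective _ x
    rfl
  map_map k m n hkm hmn x := by
    obtain ⟨z, rfl⟩ := Submodule.Quotient.mk_surjective _ x
    rfl

theorem IsStronglyLAAcyclic.isLAAcyclic {H : Type*} [Group H] [TopologicalSpace H] {v : H → ℕ∞}
    {b : OrderedBasis p v d} {W : Type*} [NormedAddCommGroup W] [NormedSpace ℚ_[p] W]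
    {ρ : Representation ℚ_[p] H W} (h : IsStronglyLAAcyclic b ρ) : IsLAAcyclic b ρ := by
  intro i hi
  refine subsingleton_of_forall_eq 0 fun z => ?_
  obtain ⟨n, x, rfl⟩ := Module.DirectLimit.exists_of z
  obtain ⟨m, hnm, h0⟩ := h i hi n
  rw [← Module.DirectLimit.of_f (hij := hnm), h0, LinearMap.zero_apply, map_zero]

/-- A class that is zero in a direct limit is already zero at a finite stage, which depends on the
class. -/
theorem IsLAAcyclic.exists_transition_eq_zero {H : Type*} [Group H] [TopologicalSpace H]
    {v : H → ℕ∞} {b : OrderedBasis p v d} {W : Type*} [NormedAddCommGroup W]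
    [NormedSpace ℚ_[p] W] {ρ : Representation ℚ_[p] H W} (h : IsLAAcyclic b ρ) {i n : ℕ}
    (hi : 1 ≤ i) (x : Hcont b ρ n i) : ∃ m, ∃ hnm : n ≤ m, transition b ρ i n m hnm x = 0 := by
  have := h i hi
  have hx : Module.DirectLimit.of ℚ_[p] ℕ (fun n => Hcont b ρ n i) (transition b ρ i) n x = 0 :=
    Subsingleton.elim (α := RLA b ρ i) _ _
  exact Module.DirectLimit.of.zero_exact (G := fun n => Hcont b ρ n i) hx

theorem IsLAAcyclic.isStronglyLAAcyclic {W : Type*} [NormedAddCommGroup W] [NormedSpace ℚ_[p] W]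
    [IsUltrametricDist W] [CompleteSpace W] {b : OrderedBasis p v d}
    (hv : IsIntegralSaturatedPValuation p v) {ρ : Representation ℚ_[p] H W}
    (hρ : ∀ g, Continuous (ρ g)) (h : IsLAAcyclic b ρ) : IsStronglyLAAcyclic b ρ := by
  intro i hi n
  obtain ⟨i, rfl⟩ := Nat.exists_eq_add_of_le' hi
  have := compactSpace_powSubgroup b hv
  -- the Banach space of coefficient families of cocycles
  let Z := LinearMap.ker ((diff ρ n (i + 1)).comp (toCochain b hv W n (i + 1)))
  have hZ : IsClosed (Z : Set C(Fin (i + 1) → powSubgroup p H n, C₀(Fin d → ℕ, W))) :=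
    isClosed_singleton.preimage
      ((continuous_diff ρ hρ n (i + 1)).comp (continuous_toCochain b hv W n (i + 1)))
  have : CompleteSpace Z := hZ.completeSpace_coe
  -- Here `L` restricts a cocycle to level `m` and `D` is the coboundary from degree `i` at level
  -- `m`, both with values in all functions.
  obtain ⟨m, hm⟩ := exists_forall_mem_range (𝕜 := ℚ_[p]) (F := Z) (ι := {m // n ≤ m})
    (E := fun m => C(Fin i → powSubgroup p H m.1, C₀(Fin d → ℕ, W)))
    (Y := fun m => (Fin (i + 1) → powSubgroup p H m.1) → powSubgroup p H m.1 → W)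
    (fun m => ContinuousLinearMap.comp
      ⟨(resFun p H W m.2 (i + 1)).comp (toCochain b hv W n (i + 1)),
        (continuous_resFun m.2 (i + 1)).comp (continuous_toCochain b hv W n (i + 1))⟩ Z.subtypeL)
    (fun m => ⟨(diff ρ m.1 i).comp (toCochain b hv W m.1 i),
      (continuous_diff ρ hρ m.1 i).comp (continuous_toCochain b hv W m.1 i)⟩) (by
      rintro ⟨A, hd⟩
      have hA : toCochain b hv W n (i + 1) A ∈ cocycles b ρ n (i + 1) :=
        ⟨(mem_cochains_iff b hv W _ _ _).2 ⟨A, rfl⟩, hd⟩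
      obtain ⟨m, hnm, hm⟩ := h.exists_transition_eq_zero hi (Submodule.Quotient.mk ⟨_, hA⟩)
      rw [transition_mk] at hm
      obtain ⟨ψ, hψ, e⟩ := hm
      obtain ⟨B, rfl⟩ := (mem_cochains_iff b hv W _ _ _).1 hψ
      exact ⟨⟨m, hnm⟩, B, e⟩)
  refine ⟨m.1, m.2, LinearMap.ext fun x => ?_⟩
  obtain ⟨⟨φ, hφ, hd⟩, rfl⟩ := Submodule.Quotient.mk_surjective _ x
  rw [LinearMap.zero_apply, transition_mk]
  obtain ⟨A, rfl⟩ := (mem_cochains_iff b hv W _ _ _).1 hφ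
  obtain ⟨B, e⟩ := hm ⟨A, hd⟩
  exact ⟨toCochain b hv W m.1 i B, (mem_cochains_iff b hv W _ _ _).2 ⟨B, rfl⟩, e⟩

end

end LocAn
end

theorem proposition2p10 (p : ℕ) [Fact p.Prime] (d : ℕ)
    {G : Type*} [Group G] [TopologicalSpace G] [ChartedSpace (Fin d → ℚ_[p]) G]
    [LieGroup 𝓘(ℚ_[p], Fin d → ℚ_[p]) ω G]
    (G₀ : Subgroup G) (hopen : IsOpen (G₀ : Set G)) (hcompact : IsCompact (G₀ : Set G))
    (v : G₀ → ℕ∞) (hv : LocAn.IsIntegralSaturatedPValuation p v)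
    (b : LocAn.OrderedBasis p v d)
    {W : Type*} [NormedAddCommGroup W] [NormedSpace ℚ_[p] W] [IsUltrametricDist W]
    [CompleteSpace W]
    (ρ : Representation ℚ_[p] G W) (hρ : Continuous fun x : G × W => ρ x.1 x.2) :
    LocAn.IsLAAcyclic b (ρ.comp G₀.subtype) ↔
      LocAn.IsStronglyLAAcyclic b (ρ.comp G₀.subtype) := by
  have : IsTopologicalGroup G := topologicalGroup_of_lieGroup 𝓘(ℚ_[p], Fin d → ℚ_[p]) ω
  exact ⟨fun h => h.isStronglyLAAcyclic hv fun g => hρ.comp (Continuous.prodMk_right (g : G)),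
    LocAn.IsStronglyLAAcyclic.isLAAcyclic⟩
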